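/- Partitions are identified with their Ferrers diagrams, rows being indexed from the bottom to the top, and $\mu\subseteq\lambda$ denotes containment of diagrams. Let $k\ge 1$ and let $\mathcal P^k$ be the set of $k$-bounded partitions, i.e. those with $\lambda_1\le k$. For a skew shape $\gamma/\rho$ and a square $s\in\gamma$, the hook-length of $s$ is the number of cells of $\gamma/\rho$ that lie weakly to the right of $s$ in its row or weakly above $s$ in its column. The $k$-skew diagram of $\lambda\in\mathcal P^k$ is the skew diagram $\lambda/^k=\gamma/\rho$ such that (i) row $i$ of $\gamma/\rho$ has length $\lambda_i$ for all $i$, (ii) no cell of $\gamma/\rho$ has hook-length exceeding $k$, and (iii) every square of $\rho$ has hook-length exceeding $k$. The $k$-conjugate $\lambda^{\omega_k}$ is the partition formed by the column lengths of $\lambda/^k$. The $k$-Young lattice $Y^k$ is the set $\mathcal P^k$ with the order $\preceq$ given by the reflexive-transitive closure of the relation $$\lambda\prec\!\!\cdot\,\mu\quad\text{when}\quad \lambda\subseteq\mu,\quad \lambda^{\omega_k}\subseteq\mu^{\omega_k},\quad |\mu|-|\lambda|=1 .$$ For $1\le m\le k$ and $n\ge 0$ let $L^k(m,n)=\{\mu\in\mathcal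 P^k:\mu\preceq(m^n)\}$ be the principal order ideal of $Y^k$ generated by the partition $(m^n)$ with $n$ parts equal to $m$. **Theorem.** Let $1\le m\le k$ and $n\ge 0$. (a) The partitions in $L^k(m,n)$ are exactly the partitions $\mu\subseteq(m^n)$ (those with largest part at most $m$ and at most $n$ parts) that have at most $k-m+1$ (nonzero) rows of length strictly smaller than $m$. (b) If moreover $n\ge k-m+1$, then the set of partitions in $L^k(m,n)$ is the disjoint union $$\left\{\mu : \mu\subseteq (m^{k-m+1})\right\}\;\cup\;\bigcup_{i=1}^{n-(k-m+1)}\left\{\left(m^{i},\mu_1+1,\ldots,\mu_{k-m+1}+1\right) : \mu\subseteq \left((m-1)^{k-m+1}\right)\right\},$$ where $\mu_j=0$ for $j$ larger than the number of parts of $\mu$ (all the sets displayed are pairwise disjoint). -/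

import Mathlib

/-- The Young diagram of the rectangular partition `(m^n)`: `n` rows, each of length `m`. -/
def rectDiagram (m n : ℕ) : YoungDiagram where
  cells := Finset.range n ×ˢ Finset.range m
  isLowerSet := by
    rintro ⟨i, j⟩ ⟨i', j'⟩ h hc
    have h1 : i' ≤ i := h.1
    have h2 : j' ≤ j := h.2
    simp only [Finset.coe_product, Finset.coe_range, Set.mem_prod, Set.mem_Iio] at hc ⊢
    omega

/-- The hook length of the square `(i, j)` with respect to the skew shape `γ/ρ`: the number of cells
of `γ/ρ` lying in the L-shape with corner `(i, j)`, i.e. in row `i` weakly to the right of `(i, j)`,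
or in column `j` in rows of index at least `i` (that is, weakly above `(i, j)` when rows are drawn
from bottom to top). It is meaningful also for squares of `ρ`. -/
def skewHookLength (γ ρ : YoungDiagram) (i j : ℕ) : ℕ :=
  ((γ.cells \ ρ.cells).filter
    (fun c => (c.1 = i ∧ j ≤ c.2) ∨ (c.2 = j ∧ i ≤ c.1))).card

/-- `γ/ρ` is the `k`-skew diagram of the partition `μ`. -/
structure IsKSkewDiagram (k : ℕ) (μ γ ρ : YoungDiagram) : Prop where
  /-- `γ/ρ` is a skew shape -/
  le : ρ ≤ γ
  /-- row `i` of `γ/ρ` has length `μ_i` -/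
  row_length : ∀ i, γ.rowLen i = ρ.rowLen i + μ.rowLen i
  /-- no cell of `γ/ρ` has a hook length exceeding `k` -/
  hook_le : ∀ i j, (i, j) ∈ γ → (i, j) ∉ ρ → skewHookLength γ ρ i j ≤ k
  /-- every square below the diagram `γ/ρ` has hook length exceeding `k` -/
  lt_hook : ∀ i j, (i, j) ∈ ρ → k < skewHookLength γ ρ i j

/-- `ν` is the `k`-conjugate of `μ`: the partition whose parts are the column lengths of
the `k`-skew diagram of `μ`. -/
def IsKConjugate (k : ℕ) (μ ν : YoungDiagram) : Prop :=
  ∃ γ ρ : YoungDiagram, IsKSkewDiagram k μ γ ρ ∧ ∀ j, γ.colLen j = ρ.colLen j + ν.rowLen j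

/-- The `k`-bounded partitions: partitions whose first part is at most `k`. -/
@[ext]
structure KBoundedPartition (k : ℕ) where
  /-- the Ferrers diagram of the partition -/
  diagram : YoungDiagram
  /-- the first part is at most `k` -/
  bounded : diagram.rowLen 0 ≤ k

namespace KBoundedPartition

/-- The generating relation of the `k`-order: `lam` is contained in `mu`, the `k`-conjugate of `lam`
is contained in the `k`-conjugate of `mu`, and the degrees differ by one. -/
def Covers {k : ℕ} (lam mu : KBoundedPartition k) : Prop :=
  lam.diagram ≤ mu.diagram ∧
    (∃ lam' mu' : YoungDiagram,
      IsKConjugate k lam.diagram lam' ∧ IsKConjugate k mu.diagram mu' ∧ lam' ≤ mu') ∧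
    mu.diagram.card = lam.diagram.card + 1

theorem diagram_le_of_reflTransGen {k : ℕ} {lam mu : KBoundedPartition k}
    (h : Relation.ReflTransGen Covers lam mu) : lam.diagram ≤ mu.diagram := by
  induction h with
  | refl => exact le_rfl
  | tail _ h ih => exact ih.trans h.1

/-- The `k`-Young lattice `Y^k`: the `k`-bounded partitions, ordered by the (reflexive and)
transitive closure of `Covers`. -/
instance instPartialOrder (k : ℕ) : PartialOrder (KBoundedPartition k) where
  le lam mu := Relation.ReflTransGen Covers lam mu
  le_refl _ := Relation.ReflTransGen.refl
  le_trans _ _ _ := Relation.ReflTransGen.trans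
  le_antisymm _ _ h₁ h₂ := KBoundedPartition.ext
    (le_antisymm (diagram_le_of_reflTransGen h₁) (diagram_le_of_reflTransGen h₂))

/-- The rectangular partition `(m^n)` as a `k`-bounded partition, for `m ≤ k`. -/
def rect (k m n : ℕ) (hmk : m ≤ k) : KBoundedPartition k where
  diagram := rectDiagram m n
  bounded := by
    by_contra hlt
    have h : (0, m) ∈ rectDiagram m n := YoungDiagram.mem_iff_lt_rowLen.2 (by omega)
    have h' : (0, m) ∈ Finset.range n ×ˢ Finset.range m := h
    simp at h'

end KBoundedPartition

/-- The set `L^k(m,n)` of partitions in the principal order ideal of `Y^k` generated by `(m^n)`. -/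
def kRectIdeal (k m n : ℕ) (hmk : m ≤ k) : Set YoungDiagram :=
  KBoundedPartition.diagram '' Set.Iic (KBoundedPartition.rect k m n hmk)

/-- The number of (nonempty) rows of `μ` that are shorter than `m`. -/
def numRowsShorter (μ : YoungDiagram) (m : ℕ) : ℕ :=
  (μ.rowLens.filter (fun r => r < m)).length

/-- The set of partitions `(m^i, μ_1 + 1, …, μ_s + 1)` for `μ ⊆ ((m-1)^s)`. -/
def stackedFamily (m s i : ℕ) : Set YoungDiagram :=
  {ν | ∃ μ : YoungDiagram, μ ≤ rectDiagram (m - 1) s ∧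
    ν.rowLens = List.replicate i m ++ (List.range s).map (fun r => μ.rowLen r + 1)}

/-!
Put `b = k - m + 1`. A partition contained in `(m^n)` has at most `b` nonempty rows shorter than `m`
if and only if row `i` has length at least `m` whenever row `i + b` is nonempty
(`numRowsShorter_le_iff`). In the latter form the condition is easy to test against hook lengths,
because a full row of length `m` with `b` cells above it produces the hook length `m + b = k + 1`.

For a partition `μ` satisfying this condition, the `k`-skew diagram is explicit: row `i` of the
outer shape `γ` has length `∑ t, μ_{i + t b}` (`periodicSum`), and row `i` of the inner shape is
row `i + b` of `γ`, so that each row starts just to the right of the row lying `b` places above it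
(`isKSkewDiagram_periodicSum`). Hence column `j` of the `k`-skew diagram has `min b γ'_j` cells,
where `γ'_j` is the height of column `j` of `γ`. Since `γ` is visibly monotone in `μ`, so is the
`k`-conjugate, and among such partitions every containment of degree one is a cover of `Y^k`.
Adding cells to the lowest row shorter than `m` preserves the condition and ends at `(m^n)`, so all
these partitions lie in the ideal (`le_rect_of_isNearRect`).

Conversely, the condition is inherited by everything below (`isNearRect_of_covers`). When it holds
for `lam`, the `k`-conjugate of `lam` has first part at most `b` (`kConjugate_rowLen_zero_le`). If
removing a cell from `lam` destroys it, the cell is the last one of a full row `i` with exactly `b`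
nonempty rows above it; now row `i` of the `k`-skew diagram is no longer shifted, so the first
column has at least `b + 1` cells, and the containment of `k`-conjugates fails.

The decomposition in the second part sorts the partitions by their number of rows.
-/

namespace YoungDiagram

/-! ### Young diagrams from row length functions -/

/-- The Young diagram with row lengths `f 0 ≥ f 1 ≥ …`, where `f` vanishes at `N`. -/
def ofRowFun (f : ℕ → ℕ) (hf : Antitone f) (N : ℕ) : YoungDiagram where
  cells := (Finset.range N ×ˢ Finset.range (f 0)).filter fun c => c.2 < f c.1
  isLowerSet := by
    rintro ⟨i, j⟩ ⟨i', j'⟩ h hc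
    have h1 : i' ≤ i := h.1
    have h2 : j' ≤ j := h.2
    have h3 := hf h1
    simp only [Finset.coe_filter, Finset.mem_product, Finset.mem_range, Set.mem_ofPred_eq] at hc ⊢
    omega

theorem rowLen_ofRowFun {f : ℕ → ℕ} (hf : Antitone f) {N : ℕ} (hN : f N = 0) (i : ℕ) :
    (ofRowFun f hf N).rowLen i = f i := by
  refine eq_of_forall_lt_iff fun j => ?_
  rw [← mem_iff_lt_rowLen, ← mem_cells]
  simp only [ofRowFun, Finset.mem_filter, Finset.mem_product, Finset.mem_range]
  have h0 := hf (Nat.zero_le i)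
  have h1 : N ≤ i → f i ≤ f N := fun h => hf h
  omega

theorem rowLen_eq_zero_of_colLen_le (μ : YoungDiagram) {i : ℕ} (h : μ.colLen 0 ≤ i) :
    μ.rowLen i = 0 := by
  by_contra h0
  have := mem_iff_lt_colLen.1 (mem_iff_lt_rowLen.2 (Nat.pos_of_ne_zero h0))
  omega

theorem rowLen_mono {μ ν : YoungDiagram} (h : μ ≤ ν) (i : ℕ) : μ.rowLen i ≤ ν.rowLen i :=
  le_of_forall_lt fun _ hj => mem_iff_lt_rowLen.1 (h (mem_iff_lt_rowLen.2 hj))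

theorem colLen_mono {μ ν : YoungDiagram} (h : μ ≤ ν) (j : ℕ) : μ.colLen j ≤ ν.colLen j :=
  le_of_forall_lt fun _ hi => mem_iff_lt_colLen.1 (h (mem_iff_lt_colLen.2 hi))

theorem le_of_rowLen_le {μ ν : YoungDiagram} (h : ∀ i, μ.rowLen i ≤ ν.rowLen i) : μ ≤ ν := by
  rintro ⟨i, j⟩ hij
  exact mem_iff_lt_rowLen.2 ((mem_iff_lt_rowLen.1 hij).trans_le (h i))

/-- The Young diagram obtained by deleting the `d` longest rows. -/
def dropRows (γ : YoungDiagram) (d : ℕ) : YoungDiagram :=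
  ofRowFun (fun i => γ.rowLen (i + d)) (fun _ _ h => γ.rowLen_anti _ _ (by omega)) (γ.colLen 0)

theorem rowLen_dropRows (γ : YoungDiagram) (d i : ℕ) :
    (γ.dropRows d).rowLen i = γ.rowLen (i + d) := by
  have h0 : γ.rowLen (γ.colLen 0 + d) = 0 :=
    γ.rowLen_eq_zero_of_colLen_le (Nat.le_add_right _ _)
  exact rowLen_ofRowFun (f := fun i => γ.rowLen (i + d)) _ h0 i

theorem mem_dropRows {γ : YoungDiagram} {d i j : ℕ} :
    (i, j) ∈ γ.dropRows d ↔ (i + d, j) ∈ γ := by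
  rw [mem_iff_lt_rowLen, rowLen_dropRows, mem_iff_lt_rowLen]

theorem colLen_dropRows (γ : YoungDiagram) (d j : ℕ) :
    (γ.dropRows d).colLen j = γ.colLen j - d := by
  refine eq_of_forall_lt_iff fun i => ?_
  rw [← mem_iff_lt_colLen, mem_dropRows, mem_iff_lt_colLen]
  omega

/-- The conjugate of the diagram formed by the `b` longest rows: its rows are the columns of `γ`
truncated at height `b`. -/
def truncConj (γ : YoungDiagram) (b : ℕ) : YoungDiagram :=
  ofRowFun (fun j => min b (γ.colLen j))
    (fun _ _ h => min_le_min le_rfl (γ.colLen_anti _ _ h)) (γ.rowLen 0)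

theorem rowLen_truncConj (γ : YoungDiagram) (b j : ℕ) :
    (γ.truncConj b).rowLen j = min b (γ.colLen j) := by
  refine rowLen_ofRowFun _ ?_ j
  have h : ¬ 0 < γ.colLen (γ.rowLen 0) := fun h =>
    lt_irrefl _ (mem_iff_lt_rowLen.1 (mem_iff_lt_colLen.2 h))
  simp only [Nat.eq_zero_of_not_pos h, Nat.min_zero]

theorem truncConj_mono {γ δ : YoungDiagram} (h : γ ≤ δ) (b : ℕ) :
    γ.truncConj b ≤ δ.truncConj b :=
  le_of_rowLen_le fun j => by
    rw [rowLen_truncConj, rowLen_truncConj]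
    exact min_le_min le_rfl (colLen_mono h j)

/-- The Young diagram whose row `i` has length `∑ t, μ_{i + t b}`. For `1 ≤ b`, the sum over
`t < μ.colLen 0` contains all the nonzero terms. -/
def periodicSum (μ : YoungDiagram) (b : ℕ) : YoungDiagram :=
  ofRowFun (fun i => ∑ t ∈ Finset.range (μ.colLen 0), μ.rowLen (i + t * b))
    (fun _ _ h => Finset.sum_le_sum fun _ _ => μ.rowLen_anti _ _ (by omega)) (μ.colLen 0)

theorem rowLen_periodicSum (μ : YoungDiagram) (b i : ℕ) :
    (μ.periodicSum b).rowLen i =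
      ∑ t ∈ Finset.range (μ.colLen 0), μ.rowLen (i + t * b) :=
  rowLen_ofRowFun _
    (Finset.sum_eq_zero fun _ _ => μ.rowLen_eq_zero_of_colLen_le (Nat.le_add_right _ _)) i

theorem periodicSum_mono {μ ν : YoungDiagram} (h : μ ≤ ν) (b : ℕ) :
    μ.periodicSum b ≤ ν.periodicSum b :=
  le_of_rowLen_le fun i => by
    rw [rowLen_periodicSum, rowLen_periodicSum]
    exact (Finset.sum_le_sum fun _ _ => rowLen_mono h _).trans
      (Finset.sum_le_sum_of_subset (Finset.range_mono (colLen_mono h 0)))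

theorem rowLen_periodicSum_eq_add (μ : YoungDiagram) {b : ℕ} (hb : 1 ≤ b) (i : ℕ) :
    (μ.periodicSum b).rowLen i = (μ.periodicSum b).rowLen (i + b) + μ.rowLen i := by
  -- The sum may be taken up to `colLen 0 + 1`, since the additional term vanishes.
  have h0 : μ.rowLen (i + μ.colLen 0 * b) = 0 :=
    μ.rowLen_eq_zero_of_colLen_le ((Nat.le_mul_of_pos_right _ hb).trans (Nat.le_add_left _ _))
  have h1 := Finset.sum_range_succ (fun t => μ.rowLen (i + t * b)) (μ.colLen 0)
  rw [Finset.sum_range_succ'] at h1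
  simp only [h0, zero_mul, add_zero] at h1
  rw [rowLen_periodicSum, rowLen_periodicSum, ← h1]
  congr 1
  exact Finset.sum_congr rfl fun t _ => by congr 1; ring

theorem mem_of_mem_periodicSum {μ : YoungDiagram} {b i j : ℕ} (h : (i, j) ∈ μ.periodicSum b) :
    (i, 0) ∈ μ := by
  rw [mem_iff_lt_rowLen, rowLen_periodicSum] at h
  obtain ⟨t, -, ht⟩ := Finset.exists_ne_zero_of_sum_ne_zero (Nat.ne_of_gt (Nat.zero_lt_of_lt h))
  exact μ.up_left_mem (Nat.le_add_right _ _) le_rfl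
    (mem_iff_lt_rowLen.2 (Nat.pos_of_ne_zero ht))

end YoungDiagram

open YoungDiagram

/-! ### Bounds for hook lengths -/

theorem skewHookLength_le {γ ρ : YoungDiagram} {i j : ℕ} (A B : Finset ℕ)
    (hA : ∀ j', j ≤ j' → (i, j') ∈ γ → (i, j') ∉ ρ → j' ∈ A)
    (hB : ∀ i', i < i' → (i', j) ∈ γ → (i', j) ∉ ρ → i' ∈ B) :
    skewHookLength γ ρ i j ≤ A.card + B.card := by
  have hsub : (γ.cells \ ρ.cells).filter
      (fun c => (c.1 = i ∧ j ≤ c.2) ∨ (c.2 = j ∧ i ≤ c.1)) ⊆ {i} ×ˢ A ∪ B ×ˢ {j} := by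
    rintro ⟨i', j'⟩ hc
    simp only [Finset.mem_filter, Finset.mem_sdiff, mem_cells] at hc
    simp only [Finset.mem_union, Finset.mem_product, Finset.mem_singleton]
    obtain ⟨⟨h1, h2⟩, ⟨rfl, h3⟩ | ⟨rfl, h3⟩⟩ := hc
    · exact Or.inl ⟨rfl, hA _ h3 h1 h2⟩
    · rcases h3.eq_or_lt with rfl | h3
      · exact Or.inl ⟨rfl, hA _ le_rfl h1 h2⟩
      · exact Or.inr ⟨hB _ h3 h1 h2, rfl⟩
  calc skewHookLength γ ρ i j ≤ ({i} ×ˢ A ∪ B ×ˢ {j}).card := Finset.card_le_card hsub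
    _ ≤ ({i} ×ˢ A).card + (B ×ˢ {j}).card := Finset.card_union_le _ _
    _ = A.card + B.card := by simp

theorem le_skewHookLength {γ ρ : YoungDiagram} {i j : ℕ} (A B : Finset ℕ)
    (hA : ∀ j' ∈ A, j ≤ j' ∧ (i, j') ∈ γ ∧ (i, j') ∉ ρ)
    (hB : ∀ i' ∈ B, i < i' ∧ (i', j) ∈ γ ∧ (i', j) ∉ ρ) :
    A.card + B.card ≤ skewHookLength γ ρ i j := by
  have hdisj : Disjoint (({i} : Finset ℕ) ×ˢ A) (B ×ˢ ({j} : Finset ℕ)) := by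
    rw [Finset.disjoint_left]
    rintro ⟨i', j'⟩ h1 h2
    simp only [Finset.mem_product, Finset.mem_singleton] at h1 h2
    have := (hB _ h2.1).1
    omega
  calc A.card + B.card = ({i} ×ˢ A ∪ B ×ˢ {j}).card := by
        rw [Finset.card_union_of_disjoint hdisj]; simp
    _ ≤ skewHookLength γ ρ i j := by
        refine Finset.card_le_card ?_
        rintro ⟨i', j'⟩ hc
        simp only [Finset.mem_union, Finset.mem_product, Finset.mem_singleton] at hc
        simp only [Finset.mem_filter, Finset.mem_sdiff, mem_cells]
        rcases hc with ⟨rfl, h⟩ | ⟨h, rfl⟩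
        · exact ⟨(hA _ h).2, Or.inl ⟨rfl, (hA _ h).1⟩⟩
        · exact ⟨(hB _ h).2, Or.inr ⟨rfl, (hB _ h).1.le⟩⟩

/-! ### Partitions with few short rows -/

theorem mem_rectDiagram {m n i j : ℕ} : (i, j) ∈ rectDiagram m n ↔ i < n ∧ j < m := by
  rw [← mem_cells]
  simp only [rectDiagram, Finset.mem_product, Finset.mem_range]

theorem le_rectDiagram_iff {m n : ℕ} {μ : YoungDiagram} :
    μ ≤ rectDiagram m n ↔ μ.colLen 0 ≤ n ∧ μ.rowLen 0 ≤ m := by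
  constructor
  · intro h
    refine ⟨le_of_forall_lt fun i hi => ?_, le_of_forall_lt fun j hj => ?_⟩
    · exact (mem_rectDiagram.1 (h (mem_iff_lt_colLen.2 hi))).1
    · exact (mem_rectDiagram.1 (h (mem_iff_lt_rowLen.2 hj))).2
  · rintro ⟨h1, h2⟩ ⟨i, j⟩ hij
    have hi := mem_iff_lt_colLen.1 (μ.up_left_mem le_rfl (Nat.zero_le _) hij)
    have hj := mem_iff_lt_rowLen.1 (μ.up_left_mem (Nat.zero_le _) le_rfl hij)
    exact mem_rectDiagram.2 ⟨hi.trans_le h1, hj.trans_le h2⟩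

/-- `μ` is contained in `(m^n)`, and row `i` of `μ` is full (has length `m`) as soon as row `i + b`
is nonempty. Equivalently, at most `b` nonempty rows are not full. -/
structure IsNearRect (m n b : ℕ) (μ : YoungDiagram) : Prop where
  le : μ ≤ rectDiagram m n
  full : ∀ i, (i + b, 0) ∈ μ → (i, m - 1) ∈ μ

theorem numRowsShorter_eq_card (μ : YoungDiagram) (m : ℕ) :
    numRowsShorter μ m = ((Finset.range (μ.colLen 0)).filter fun i => μ.rowLen i < m).card := by
  rw [numRowsShorter, rowLens, List.filter_map, List.length_map]
  rfl

theorem numRowsShorter_le_iff {m b : ℕ} (hm : 1 ≤ m) (μ : YoungDiagram) :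
    numRowsShorter μ m ≤ b ↔ ∀ i, (i + b, 0) ∈ μ → (i, m - 1) ∈ μ := by
  rw [numRowsShorter_eq_card]
  constructor
  · intro h i hi
    by_contra hfull
    -- Rows `i, …, i + b` would all be nonempty and short.
    have hsub : Finset.Icc i (i + b) ⊆
        (Finset.range (μ.colLen 0)).filter fun i => μ.rowLen i < m := by
      intro i' hi'
      rw [Finset.mem_Icc] at hi'
      rw [mem_iff_lt_colLen] at hi
      rw [mem_iff_lt_rowLen] at hfull
      have := μ.rowLen_anti i i' hi'.1
      rw [Finset.mem_filter, Finset.mem_range]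
      omega
    have := Finset.card_le_card hsub
    rw [Nat.card_Icc] at this
    omega
  · intro h
    have hsub : ((Finset.range (μ.colLen 0)).filter fun i => μ.rowLen i < m) ⊆
        Finset.Ico (μ.colLen 0 - b) (μ.colLen 0) := by
      intro i hi
      rw [Finset.mem_filter, Finset.mem_range] at hi
      have h1 := h i
      rw [mem_iff_lt_colLen, mem_iff_lt_rowLen] at h1
      rw [Finset.mem_Ico]
      omega
    have := Finset.card_le_card hsub
    rw [Nat.card_Ico] at this
    omega

theorem isNearRect_iff {m n b : ℕ} (hm : 1 ≤ m) (μ : YoungDiagram) :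
    IsNearRect m n b μ ↔ μ ≤ rectDiagram m n ∧ numRowsShorter μ m ≤ b := by
  rw [numRowsShorter_le_iff hm]
  exact ⟨fun h => ⟨h.1, h.2⟩, fun h => ⟨h.1, h.2⟩⟩

theorem isNearRect_rectDiagram {m n b : ℕ} (hm : 1 ≤ m) : IsNearRect m n b (rectDiagram m n) where
  le := le_rfl
  full i h := by
    rw [mem_rectDiagram] at h ⊢
    omega

/-! ### The `k`-skew diagram and the `k`-conjugate -/

theorem isKSkewDiagram_periodicSum {k m n b : ℕ} (hb : 1 ≤ b) (hk : m + b = k + 1)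
    {μ : YoungDiagram} (hμ : IsNearRect m n b μ) :
    IsKSkewDiagram k μ (μ.periodicSum b) ((μ.periodicSum b).dropRows b) where
  le := le_of_rowLen_le fun i => by
    rw [rowLen_dropRows]
    exact rowLen_anti _ _ _ (Nat.le_add_right _ _)
  row_length i := by rw [rowLen_dropRows, ← rowLen_periodicSum_eq_add μ hb]
  hook_le i j _ hρ := by
    -- A column has at most `b` cells, so at most `b - 1` of them lie above row `i`.
    have hle := skewHookLength_le (γ := μ.periodicSum b) (ρ := (μ.periodicSum b).dropRows b)
      (i := i) (j := j)
      (Finset.Ico ((μ.periodicSum b).rowLen (i + b)) ((μ.periodicSum b).rowLen i))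
      (Finset.Ioo i (i + b))
      (fun j' _ h1 h2 => by
        rw [mem_dropRows, mem_iff_lt_rowLen] at h2
        rw [mem_iff_lt_rowLen] at h1
        rw [Finset.mem_Ico]
        omega)
      (fun i' hi h1 _ => by
        rw [mem_dropRows, mem_iff_lt_colLen] at hρ
        rw [mem_iff_lt_colLen] at h1
        rw [Finset.mem_Ioo]
        omega)
    have h1 := rowLen_periodicSum_eq_add μ hb i
    have h2 := (le_rectDiagram_iff.1 hμ.le).2
    have h3 := μ.rowLen_anti 0 i (Nat.zero_le _)
    rw [Nat.card_Ico, Nat.card_Ioo] at hle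
    omega
  lt_hook i j hρ := by
    -- Row `i` is full, and all the `b` cells of column `j` lie above it.
    rw [mem_dropRows] at hρ
    have hfull := mem_iff_lt_rowLen.1 (hμ.full i (mem_of_mem_periodicSum hρ))
    have hj := mem_iff_lt_rowLen.1 hρ
    have hi := mem_iff_lt_colLen.1 hρ
    have hle := le_skewHookLength (γ := μ.periodicSum b) (ρ := (μ.periodicSum b).dropRows b)
      (i := i) (j := j)
      (Finset.Ico ((μ.periodicSum b).rowLen (i + b)) ((μ.periodicSum b).rowLen i))
      (Finset.Ico ((μ.periodicSum b).colLen j - b) ((μ.periodicSum b).colLen j))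
      (fun j' h => by
        rw [Finset.mem_Ico] at h
        rw [mem_dropRows, mem_iff_lt_rowLen, mem_iff_lt_rowLen]
        omega)
      (fun i' h => by
        rw [Finset.mem_Ico] at h
        rw [mem_dropRows, mem_iff_lt_colLen, mem_iff_lt_colLen]
        omega)
    have h1 := rowLen_periodicSum_eq_add μ hb i
    rw [Nat.card_Ico, Nat.card_Ico] at hle
    omega

theorem isKConjugate_truncConj {k m n b : ℕ} (hb : 1 ≤ b) (hk : m + b = k + 1)
    {μ : YoungDiagram} (hμ : IsNearRect m n b μ) :
    IsKConjugate k μ ((μ.periodicSum b).truncConj b) :=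
  ⟨_, _, isKSkewDiagram_periodicSum hb hk hμ, fun j => by
    rw [colLen_dropRows, rowLen_truncConj]
    omega⟩

theorem covers_of_isNearRect {k m n b : ℕ} (hb : 1 ≤ b) (hk : m + b = k + 1)
    {lam mu : KBoundedPartition k} (hlam : IsNearRect m n b lam.diagram)
    (hmu : IsNearRect m n b mu.diagram) (hle : lam.diagram ≤ mu.diagram)
    (hcard : mu.diagram.card = lam.diagram.card + 1) : lam.Covers mu :=
  ⟨hle, ⟨_, _, isKConjugate_truncConj hb hk hlam, isKConjugate_truncConj hb hk hmu,
    truncConj_mono (periodicSum_mono hle b) b⟩, hcard⟩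

/-- If the first column had `b + 1` cells, the lowest of them would start a full row and have
hook length at least `m + b`. -/
theorem kConjugate_rowLen_zero_le {k m n b : ℕ} (hk : m + b = k + 1) {lam ν : YoungDiagram}
    (hlam : IsNearRect m n b lam) (hν : IsKConjugate k lam ν) : ν.rowLen 0 ≤ b := by
  obtain ⟨γ, ρ, h, hcol⟩ := hν
  by_contra! hlt
  have hc := hcol 0
  set i := ρ.colLen 0 with hi
  have hρ : ∀ i', i ≤ i' → ρ.rowLen i' = 0 := fun i' h' => ρ.rowLen_eq_zero_of_colLen_le h'
  have hγ : (i + b, 0) ∈ γ := mem_iff_lt_colLen.2 (by omega)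
  have htop := h.row_length (i + b)
  rw [hρ _ (Nat.le_add_right _ _), zero_add] at htop
  have hrow := h.row_length i
  rw [hρ _ le_rfl, zero_add] at hrow
  have hfull := mem_iff_lt_rowLen.1 (hlam.full i
    (mem_iff_lt_rowLen.2 (htop ▸ mem_iff_lt_rowLen.1 hγ)))
  have hle := le_skewHookLength (γ := γ) (ρ := ρ) (i := i) (j := 0)
    (Finset.range (lam.rowLen i)) (Finset.Ioc i (i + b))
    (fun j' h' => by
      rw [Finset.mem_range] at h'
      rw [mem_iff_lt_rowLen, mem_iff_lt_rowLen, hρ _ le_rfl]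
      omega)
    (fun i' h' => by
      rw [Finset.mem_Ioc] at h'
      rw [mem_iff_lt_colLen, mem_iff_lt_colLen]
      omega)
  have hhook := h.hook_le i 0 (γ.up_left_mem (Nat.le_add_right _ _) le_rfl hγ)
    (fun h' => by rw [mem_iff_lt_colLen] at h'; omega)
  rw [Finset.card_range, Nat.card_Ioc] at hle
  omega

/-- A short row with exactly `b` nonempty rows above it is not shifted in the `k`-skew diagram, so
these rows give `b + 1` cells of the first column. -/
theorem lt_kConjugate_rowLen_zero {k m b i : ℕ} (hk : m + b = k + 1) {μ ν : YoungDiagram}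
    (hν : IsKConjugate k μ ν) (hi : (i + b, 0) ∈ μ) (hi' : (i + b + 1, 0) ∉ μ)
    (hshort : (i, m - 1) ∉ μ) : b < ν.rowLen 0 := by
  obtain ⟨γ, ρ, h, hcol⟩ := hν
  have hρ : (i, 0) ∉ ρ := by
    intro hmem
    have hlt := h.lt_hook i 0 hmem
    have hle := skewHookLength_le (γ := γ) (ρ := ρ) (i := i) (j := 0)
      (Finset.Ico (ρ.rowLen i) (γ.rowLen i)) (Finset.Ioc i (i + b))
      (fun j' _ h1 h2 => by
        rw [mem_iff_lt_rowLen] at h1 h2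
        rw [Finset.mem_Ico]
        omega)
      (fun i' hi1 h1 h2 => by
        have hrow := h.row_length i'
        rw [mem_iff_lt_rowLen] at h1 h2
        have hne : (i', 0) ∈ μ := mem_iff_lt_rowLen.2 (by omega)
        rw [mem_iff_lt_colLen] at hi' hne
        rw [Finset.mem_Ioc]
        omega)
    have hrow := h.row_length i
    have hpos := mem_iff_lt_rowLen.1 (μ.up_left_mem (Nat.le_add_right i b) le_rfl hi)
    rw [mem_iff_lt_rowLen] at hshort
    rw [Nat.card_Ico, Nat.card_Ioc] at hle
    omega
  have hγ : (i + b, 0) ∈ γ := by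
    have hrow := h.row_length (i + b)
    rw [mem_iff_lt_rowLen] at hi ⊢
    omega
  have hc := hcol 0
  rw [mem_iff_lt_colLen] at hρ hγ
  omega

/-! ### The principal order ideal -/

theorem isNearRect_of_covers {k m n b : ℕ} (hk : m + b = k + 1)
    {lam mu : KBoundedPartition k} (hmu : IsNearRect m n b mu.diagram) (h : lam.Covers mu) :
    IsNearRect m n b lam.diagram := by
  obtain ⟨hle, ⟨lam', mu', hlam', hmu', hle'⟩, hcard⟩ := h
  refine ⟨hle.trans hmu.le, fun i hi => ?_⟩
  by_contra hshort
  have hfull := hmu.full i (hle hi)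
  -- The only cell of `mu` outside `lam` is the last cell of row `i`.
  have honly : ∀ c ∈ mu.diagram, c ∉ lam.diagram → c = (i, m - 1) := by
    intro c hc hc'
    have hsub : lam.diagram.cells ⊆ mu.diagram.cells := hle
    have h1 : (mu.diagram.cells \ lam.diagram.cells).card ≤ 1 := by
      rw [Finset.card_sdiff_of_subset hsub]
      have : mu.diagram.cells.card = lam.diagram.cells.card + 1 := hcard
      omega
    exact Finset.card_le_one.1 h1 _ (Finset.mem_sdiff.2 ⟨hc, hc'⟩) _
      (Finset.mem_sdiff.2 ⟨hfull, hshort⟩)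
  have htop : (i + b + 1, 0) ∉ lam.diagram := by
    intro htop
    have h1 := hmu.full (i + 1) (by rw [Nat.add_right_comm]; exact hle htop)
    by_cases h2 : (i + 1, m - 1) ∈ lam.diagram
    · exact hshort (lam.diagram.up_left_mem (Nat.le_succ i) le_rfl h2)
    · have := congrArg Prod.fst (honly _ h1 h2)
      simp at this
  have h1 := lt_kConjugate_rowLen_zero hk hlam' hi htop hshort
  have h2 := kConjugate_rowLen_zero_le hk hmu hmu'
  have h3 := rowLen_mono hle' 0
  omega

/-- The new cell goes into the lowest row that is not full. -/
theorem IsNearRect.exists_insert {m n b : ℕ} (hm : 1 ≤ m) (hb : 1 ≤ b) {μ : YoungDiagram}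
    (hμ : IsNearRect m n b μ) (hne : μ ≠ rectDiagram m n) :
    ∃ ν, IsNearRect m n b ν ∧ μ ≤ ν ∧ ν.card = μ.card + 1 := by
  classical
  have hex : ∃ a, (a, m - 1) ∉ μ := μ.exists_notMem_col (m - 1)
  obtain ⟨a, ha, hmin⟩ : ∃ a, (a, m - 1) ∉ μ ∧ ∀ a' < a, (a', m - 1) ∈ μ :=
    ⟨Nat.find hex, Nat.find_spec hex, fun a' h => not_not.1 (Nat.find_min hex h)⟩
  have han : a < n := by
    by_contra! hna
    refine hne (le_antisymm hμ.le ?_)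
    rintro ⟨i, j⟩ hij
    rw [mem_rectDiagram] at hij
    exact μ.up_left_mem le_rfl (by omega) (hmin i (by omega))
  have hnew : (a, μ.rowLen a) ∉ μ := fun h => lt_irrefl _ (mem_iff_lt_rowLen.1 h)
  have hlen : μ.rowLen a ≤ m - 1 := by
    rw [mem_iff_lt_rowLen] at ha
    omega
  have hlow : IsLowerSet ((insert (a, μ.rowLen a) μ.cells : Finset (ℕ × ℕ)) : Set (ℕ × ℕ)) := by
    rintro ⟨i, j⟩ ⟨i', j'⟩ h hc
    have h1 : i' ≤ i := h.1
    have h2 : j' ≤ j := h.2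
    simp only [Finset.coe_insert, Set.mem_insert_iff, Prod.mk.injEq, Finset.mem_coe,
      mem_cells] at hc ⊢
    rcases hc with ⟨rfl, rfl⟩ | hc
    · rcases h1.eq_or_lt with rfl | h1
      · rcases h2.eq_or_lt with rfl | h2
        · exact Or.inl ⟨rfl, rfl⟩
        · exact Or.inr (mem_iff_lt_rowLen.2 h2)
      · exact Or.inr (μ.up_left_mem le_rfl (h2.trans hlen) (hmin i' h1))
    · exact Or.inr (μ.up_left_mem h1 h2 hc)
  refine ⟨⟨insert (a, μ.rowLen a) μ.cells, hlow⟩, ⟨?_, fun i hi => ?_⟩,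
    Finset.subset_insert _ _, Finset.card_insert_of_notMem hnew⟩
  · intro c hc
    rcases Finset.mem_insert.1 hc with rfl | hc
    · exact mem_rectDiagram.2 ⟨han, by omega⟩
    · exact hμ.le hc
  · rw [mem_mk, Finset.mem_insert] at hi
    refine Finset.mem_insert_of_mem ?_
    rcases hi with hi | hi
    · have := congrArg Prod.fst hi
      exact hmin i (by simp only at this; omega)
    · exact hμ.full i hi

theorem le_rect_of_isNearRect {k m n b : ℕ} (hm : 1 ≤ m) (hmk : m ≤ k) (hb : 1 ≤ b)
    (hk : m + b = k + 1) (lam : KBoundedPartition k) (hlam : IsNearRect m n b lam.diagram) :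
    lam ≤ KBoundedPartition.rect k m n hmk := by
  induction hd : (rectDiagram m n).card - lam.diagram.card using Nat.strong_induction_on
    generalizing lam with
  | _ d ih =>
    by_cases hne : lam.diagram = rectDiagram m n
    · exact (KBoundedPartition.ext hne : lam = KBoundedPartition.rect k m n hmk).le
    obtain ⟨ν, hν, hle, hcard⟩ := hlam.exists_insert hm hb hne
    have hνcard : ν.card ≤ (rectDiagram m n).card := Finset.card_le_card hν.le
    exact Relation.ReflTransGen.head
      (covers_of_isNearRect (mu := ⟨ν, (le_rectDiagram_iff.1 hν.le).2.trans hmk⟩)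
        hb hk hlam hν hle hcard)
      (ih ((rectDiagram m n).card - ν.card) (by omega) _ hν rfl)

theorem kRectIdeal_eq_setOf_isNearRect {k m n : ℕ} (hm : 1 ≤ m) (hmk : m ≤ k) :
    kRectIdeal k m n hmk = {μ | IsNearRect m n (k - m + 1) μ} := by
  ext μ
  constructor
  · rintro ⟨lam, hlam, rfl⟩
    replace hlam : Relation.ReflTransGen KBoundedPartition.Covers lam
      (KBoundedPartition.rect k m n hmk) := hlam
    change IsNearRect m n (k - m + 1) lam.diagram
    induction hlam using Relation.ReflTransGen.head_induction_on with
    | refl => exact isNearRect_rectDiagram hm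
    | head h _ ih => exact isNearRect_of_covers (by omega) ih h
  · intro hμ
    exact ⟨⟨μ, (le_rectDiagram_iff.1 hμ.le).2.trans hmk⟩,
      le_rect_of_isNearRect hm hmk (by omega) (by omega) _ hμ, rfl⟩

/-! ### The decomposition by the number of rows -/

theorem mem_stackedFamily_iff {m s i : ℕ} (hm : 1 ≤ m) {ν : YoungDiagram} :
    ν ∈ stackedFamily m s i ↔ ν.colLen 0 = i + s ∧ (∀ r < i, ν.rowLen r = m) ∧
      ∀ r < s, ν.rowLen (i + r) ≤ m := by
  constructor
  · rintro ⟨μ, hμ, h⟩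
    have hlen : ν.colLen 0 = i + s := by
      have := congrArg List.length h
      simpa using this
    have hget : ∀ r < i + s, ν.rowLen r = if r < i then m else μ.rowLen (r - i) + 1 := by
      intro r hr
      have h1 : ν.rowLens[r]? = some (ν.rowLen r) := by
        rw [List.getElem?_eq_getElem (by rw [length_rowLens, hlen]; exact hr), get_rowLens]
      rw [h, List.getElem?_append, List.length_replicate] at h1
      split_ifs at h1 ⊢ with hri
      · simpa [hri] using h1.symm
      · simpa [List.getElem?_range (show r - i < s by omega)] using h1.symm
    refine ⟨hlen, fun r hr => ?_, fun r hr => ?_⟩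
    · rw [hget r (by omega), if_pos hr]
    · rw [hget (i + r) (by omega), if_neg (by omega)]
      have h1 := μ.rowLen_anti 0 (i + r - i) (Nat.zero_le _)
      have h2 := (le_rectDiagram_iff.1 hμ).2
      omega
  · rintro ⟨hlen, hfull, hshort⟩
    have hanti : Antitone fun r => ν.rowLen (i + r) - 1 := fun r r' h =>
      Nat.sub_le_sub_right (ν.rowLen_anti _ _ (by omega)) 1
    have hs : ν.rowLen (i + s) - 1 = 0 := by
      rw [ν.rowLen_eq_zero_of_colLen_le hlen.le]
    have hrow := rowLen_ofRowFun hanti hs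
    refine ⟨ofRowFun _ hanti s, ?_, ?_⟩
    · rintro ⟨r, j⟩ hrj
      have hj := mem_iff_lt_rowLen.1 hrj
      rw [hrow] at hj
      have hr : r < s := by
        by_contra! hr
        rw [ν.rowLen_eq_zero_of_colLen_le (by omega)] at hj
        omega
      have := hshort r hr
      exact mem_rectDiagram.2 ⟨hr, by omega⟩
    · refine List.ext_getElem (by simp [hlen]) fun r h1 h2 => ?_
      rw [length_rowLens, hlen] at h1
      rw [get_rowLens, List.getElem_append]
      split_ifs with hri
      · rw [List.length_replicate] at hri
        rw [List.getElem_replicate, hfull r hri]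
      · rw [List.length_replicate] at hri
        simp only [List.getElem_map, List.getElem_range, List.length_replicate, hrow]
        have hpos := mem_iff_lt_rowLen.1 (mem_iff_lt_colLen.2 (hlen ▸ h1))
        rw [Nat.add_sub_cancel' (by omega : i ≤ r)]
        omega

theorem isNearRect_iff_le_or_mem_stackedFamily {m n b : ℕ} (hm : 1 ≤ m) (hbn : b ≤ n)
    (μ : YoungDiagram) : IsNearRect m n b μ ↔
      μ ≤ rectDiagram m b ∨ ∃ i ∈ Finset.Icc 1 (n - b), μ ∈ stackedFamily m b i := by
  constructor
  · intro hμ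
    obtain ⟨hcol, hrow⟩ := le_rectDiagram_iff.1 hμ.le
    have hle : ∀ r, μ.rowLen r ≤ m := fun r => (μ.rowLen_anti 0 r (Nat.zero_le _)).trans hrow
    rcases le_or_gt (μ.colLen 0) b with h | h
    · exact Or.inl (le_rectDiagram_iff.2 ⟨h, hrow⟩)
    · refine Or.inr ⟨μ.colLen 0 - b, Finset.mem_Icc.2 (by omega),
        (mem_stackedFamily_iff hm).2 ⟨by omega, fun r hr => ?_, fun r _ => hle _⟩⟩
      have h1 := mem_iff_lt_rowLen.1 (hμ.full r (mem_iff_lt_colLen.2 (by omega)))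
      have h2 := hle r
      omega
  · rintro (h | ⟨i, hi, h⟩)
    · obtain ⟨hcol, hrow⟩ := le_rectDiagram_iff.1 h
      refine ⟨le_rectDiagram_iff.2 ⟨hcol.trans hbn, hrow⟩, fun i hi => ?_⟩
      have := mem_iff_lt_colLen.1 hi
      omega
    · rw [Finset.mem_Icc] at hi
      obtain ⟨hlen, hfull, -⟩ := (mem_stackedFamily_iff hm).1 h
      refine ⟨le_rectDiagram_iff.2 ⟨by omega, (hfull 0 (by omega)).le⟩, fun r hr => ?_⟩
      rw [mem_iff_lt_colLen] at hr
      rw [mem_iff_lt_rowLen, hfull r (by omega)]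
      omega

theorem mainTheorem2 (k m n : ℕ) (hm : 1 ≤ m) (hmk : m ≤ k) :
    kRectIdeal k m n hmk =
        {μ : YoungDiagram | μ ≤ rectDiagram m n ∧ numRowsShorter μ m ≤ k - m + 1} ∧
      (k - m + 1 ≤ n →
        kRectIdeal k m n hmk =
            {μ : YoungDiagram | μ ≤ rectDiagram m (k - m + 1)} ∪
              ⋃ i ∈ Finset.Icc 1 (n - (k - m + 1)), stackedFamily m (k - m + 1) i ∧
          (∀ i ∈ Finset.Icc 1 (n - (k - m + 1)),
            Disjoint {μ : YoungDiagram | μ ≤ rectDiagram m (k - m + 1)}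
              (stackedFamily m (k - m + 1) i)) ∧
          ((Finset.Icc 1 (n - (k - m + 1)) : Finset ℕ) : Set ℕ).PairwiseDisjoint
            (stackedFamily m (k - m + 1))) := by
  refine ⟨?_, fun hn => ⟨?_, fun i hi => ?_, fun i _ i' _ hne => ?_⟩⟩
  · rw [kRectIdeal_eq_setOf_isNearRect hm hmk]
    exact Set.ext fun μ => isNearRect_iff hm μ
  · rw [kRectIdeal_eq_setOf_isNearRect hm hmk]
    ext μ
    rw [Set.mem_ofPred_eq, isNearRect_iff_le_or_mem_stackedFamily hm hn]
    simp only [Set.mem_union, Set.mem_ofPred_eq, Set.mem_iUnion, exists_prop]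
  · rw [Set.disjoint_left]
    intro μ h1 h2
    have h3 := (le_rectDiagram_iff.1 h1).1
    have h4 := ((mem_stackedFamily_iff hm).1 h2).1
    rw [Finset.mem_Icc] at hi
    omega
  · refine Set.disjoint_left.2 fun μ h1 h2 => hne ?_
    have h3 := ((mem_stackedFamily_iff hm).1 h1).1
    have h4 := ((mem_stackedFamily_iff hm).1 h2).1
    omega
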